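/- Let $G$ be a non-compact second countable locally compact (Hausdorff) group with a left Haar measure $\mu$; write $|A|=\mu(A)$. Let $1\le p_0<\infty$ and let $\omega$ be a weight on $G$, that is, a measurable strictly positive function on $G$ with $\omega\in L^{p_0}(K)$ for every compact $K\subset G$. For $1\le p<\infty$ let $L^p(G,\omega)$ be the space of complex-valued functions $f$ with $f\omega\in L^p(G)$, with the norm $\|f\|_{p,\omega}=\big(\int_G|f\omega|^p\,d\mu\big)^{1/p}$, and put $(T_sf)(t)=f(s^{-1}t)$ for $s,t\in G$. Let $S\subset G$ be a subset that generates an abelian subgroup of $G$, and suppose that $\omega$ is $S$-admissible, that is, $T_s$ is a bounded operator of $L^{p_0}(G,\omega)$ into itself for every $s\in S$. A vector $f\in L^p(G,\omega)$ is called $S$-dense if $\{T_sf: s\in S\}$ is a dense subset of $L^p(G,\omega)$. Then the following conditions are equivalent: 1. For every $p$, $1\le p<\infty$, there is an $S$-dense vector in $L^p(G,\omega)$. 2. For some $p$, $1\le p<\infty$, there is an $S$-dense vector in $L^p(G,\omega)$. 3. For every compact set $F\subset G$ and every $\delta>0$ there exist $s\in S$ and a compact set $E\subset F$ such that $|F\setminus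 E|<\delta$ and $\operatorname{ess\,sup}_{sE\cup s^{-1}E}\,\omega<\delta$. 4. For some $p$, $1\le p<\infty$, the following holds: for every compact set $F\subset G$ and every $\delta>0$ there exist $s\in S$ and a compact set $E\subset F$ such that $|F\setminus E|<\delta$ and $\big(\int_{sE\cup s^{-1}E}\omega^p\,d\mu\big)^{1/p}<\delta$. 5. For every $p$, $1\le p<\infty$, the condition stated in 4 for this $p$ holds. -/

import Mathlib

open MeasureTheory
open scoped ENNReal NNReal Pointwise

namespace WeightedTranslates

variable {G : Type*} [Group G] [TopologicalSpace G] [MeasurableSpace G]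

/-- `ω` is a weight (relative to the exponent `p`): a measurable, strictly positive function which
is locally `p`-summable, that is, in `L^p(K)` for every compact set `K`. -/
structure IsWeight (μ : Measure G) (p : ℝ≥0∞) (ω : G → ℝ) : Prop where
  aemeasurable : AEMeasurable ω μ
  pos : ∀ t, 0 < ω t
  locally_memLp : ∀ K : Set G, IsCompact K → MemLp ω p (μ.restrict K)

/-- Left translation, `(T_s f)(t) = f (s⁻¹ t)`. -/
def translate (s : G) (f : G → ℂ) : G → ℂ := fun t => f (s⁻¹ * t)

/-- Membership in `L^p(G, ω) = {f : f ω ∈ L^p(G)}`. As usual, elements of the space are represented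
by functions, and functions that agree almost everywhere represent the same element. -/
def MemWeightedLp (μ : Measure G) (p : ℝ≥0∞) (ω : G → ℝ) (f : G → ℂ) : Prop :=
  MemLp (fun t => f t * (ω t : ℂ)) p μ

/-- The norm `‖f‖_{p,ω} = (∫ |f ω|^p)^{1/p}` of `L^p(G, ω)`, with values in `[0, ∞]`. -/
noncomputable def weightedNorm (μ : Measure G) (p : ℝ≥0∞) (ω : G → ℝ) (f : G → ℂ) : ℝ≥0∞ :=
  eLpNorm (fun t => f t * (ω t : ℂ)) p μ

/-- The weight `ω` is `S`-admissible: every translation `T_s` with `s ∈ S` is a bounded operator of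
`L^p(G, ω)` into itself. -/
def IsAdmissible (μ : Measure G) (p : ℝ≥0∞) (ω : G → ℝ) (S : Set G) : Prop :=
  ∀ s ∈ S, ∃ C : ℝ≥0, ∀ f : G → ℂ, MemWeightedLp μ p ω f →
    MemWeightedLp μ p ω (translate s f) ∧
      weightedNorm μ p ω (translate s f) ≤ C * weightedNorm μ p ω f

/-- The function `f` is an `S`-dense vector of `L^p(G, ω)`: it belongs to `L^p(G, ω)`, and its orbit
`{T_s f : s ∈ S}` is a dense subset of `L^p(G, ω)`. -/
def IsDenseVector (μ : Measure G) (p : ℝ≥0∞) (ω : G → ℝ) (S : Set G) (f : G → ℂ) : Prop :=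
  MemWeightedLp μ p ω f ∧
    (∀ s ∈ S, MemWeightedLp μ p ω (translate s f)) ∧
    ∀ g : G → ℂ, MemWeightedLp μ p ω g → ∀ ε : ℝ, 0 < ε →
      ∃ s ∈ S, weightedNorm μ p ω (translate s f - g) < ENNReal.ofReal ε

/-- For every compact `F` and `δ > 0` there are `s ∈ S` and a compact `E ⊆ F` with `μ (F \ E) < δ`
such that the essential supremum of `ω` over `sE ∪ s⁻¹E` is less than `δ`. -/
def EssSupCondition (μ : Measure G) (ω : G → ℝ) (S : Set G) : Prop :=
  ∀ F : Set G, IsCompact F → ∀ δ : ℝ, 0 < δ →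
    ∃ s ∈ S, ∃ E : Set G, IsCompact E ∧ E ⊆ F ∧ μ (F \ E) < ENNReal.ofReal δ ∧
      essSup (fun t => ENNReal.ofReal (ω t)) (μ.restrict (s • E ∪ s⁻¹ • E)) < ENNReal.ofReal δ

/-- The same condition with the `L^p`-norm of `ω` on `sE ∪ s⁻¹E`. -/
def LpCondition (μ : Measure G) (p : ℝ≥0∞) (ω : G → ℝ) (S : Set G) : Prop :=
  ∀ F : Set G, IsCompact F → ∀ δ : ℝ, 0 < δ →
    ∃ s ∈ S, ∃ E : Set G, IsCompact E ∧ E ⊆ F ∧ μ (F \ E) < ENNReal.ofReal δ ∧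
      eLpNorm ω p (μ.restrict (s • E ∪ s⁻¹ • E)) < ENNReal.ofReal δ

end WeightedTranslates

/-! Testing boundedness of `T_s` on indicators gives `ω (s * t) ≤ C * ω t` almost everywhere. This
inequality does not mention the exponent, so admissibility passes from `p₀` to every `p`
(`IsAdmissible.exponent`). The smallness conditions on `ω` are equivalent for all `p` since compact
sets have finite measure, in one direction, and by Chebyshev's inequality, in the other.

Necessity (`IsDenseVector.lpCondition`): choose a translate `h` of the dense vector close to the
indicator of `F₀ ⊆ F`. By commutativity some `T_s h` is close to `3` times the indicator of `F₁ ⊆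
F₀`. No number is near both `1` and `3`, so, off a small exceptional set, `s` moves points of `F₁`
out of `F₁` and `s⁻¹` moves them out of `F₀`. There the targets vanish while `T_s h` or `h` stays
away from `0`; as the weighted errors are small, `ω` must be small.

Sufficiency (`LpCondition.exists_translate_approx`): for bounded `u`, `v` with compact support, take
`x = 1_E u + T_{s⁻¹} (1_E v)`. Then `x` is near `u` and `T_s x` is near `v`, because the unwanted
terms live on `s⁻¹E` and `sE`, where `ω` has small norm. So the translations are topologically
transitive, and Baire category gives a dense orbit. -/

namespace WeightedTranslates

/-! ### Chebyshev's inequality and truncation -/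

section General

variable {α : Type*} [MeasurableSpace α] {μ : Measure α}

/-- Chebyshev's inequality, with a bound that is explicit in the level and the measure. -/
theorem measure_le_of_eLpNorm_le {p : ℝ≥0∞} (hp : p ≠ 0) (hp_top : p ≠ ∞) {E : Type*}
    [NormedAddCommGroup E] {g : α → E} (hg : AEStronglyMeasurable g μ) {c η : ℝ} (hc : 0 < c)
    (hη : 0 < η) (h : eLpNorm g p μ ≤ ENNReal.ofReal (c * η ^ (1 / p.toReal))) :
    μ {x | c ≤ ‖g x‖} ≤ ENNReal.ofReal η := by
  have hp' : 0 < p.toReal := ENNReal.toReal_pos hp hp_top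
  have hset : {x | c ≤ ‖g x‖} = {x | ENNReal.ofReal c ≤ ‖g x‖ₑ} := by
    ext x
    simp only [Set.mem_ofPred_eq]
    rw [← ofReal_norm, ENNReal.ofReal_le_ofReal_iff (norm_nonneg _)]
  rw [hset]
  have hc0 : ENNReal.ofReal c ≠ 0 := by simpa using hc
  refine (meas_ge_le_mul_pow_eLpNorm_enorm μ hp hp_top hg hc0 (by simp)).trans ?_
  calc (ENNReal.ofReal c)⁻¹ ^ p.toReal * eLpNorm g p μ ^ p.toReal
      ≤ (ENNReal.ofReal c)⁻¹ ^ p.toReal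
          * (ENNReal.ofReal (c * η ^ (1 / p.toReal))) ^ p.toReal := by gcongr
    _ = ENNReal.ofReal η := by
      rw [← ENNReal.mul_rpow_of_nonneg _ _ hp'.le, ENNReal.ofReal_mul hc.le, ← mul_assoc,
        ENNReal.inv_mul_cancel hc0 ENNReal.ofReal_ne_top, one_mul,
        ENNReal.ofReal_rpow_of_pos (by positivity), ← Real.rpow_mul hη.le,
        one_div_mul_cancel hp'.ne', Real.rpow_one]

/-- A real function is bounded on a set of finite measure, up to a part of small measure. -/
theorem exists_bounded_on_subset {v : α → ℝ} (hv : AEMeasurable v μ) {F : Set α}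
    (hF : MeasurableSet F) (hμF : μ F ≠ ∞) {δ : ℝ} (hδ : 0 < δ) :
    ∃ M : ℝ, 0 < M ∧ ∃ F' : Set α, MeasurableSet F' ∧ F' ⊆ F ∧
      μ (F \ F') < ENNReal.ofReal δ ∧ ∀ t ∈ F', |v t| ≤ M := by
  let B : ℕ → Set α := fun n => {t | (n : ℝ) < |v t|} ∩ F
  have hB : ∀ n, NullMeasurableSet (B n) μ := fun n =>
    (nullMeasurableSet_lt aemeasurable_const hv.abs).inter hF.nullMeasurableSet
  have hanti : Antitone B := fun m n hmn t ht =>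
    ⟨(Nat.cast_le.2 hmn).trans_lt (show (n : ℝ) < |v t| from ht.1), ht.2⟩
  have hinter : ⋂ n, B n = ∅ := by
    refine Set.eq_empty_of_forall_notMem fun t ht => ?_
    obtain ⟨n, hn⟩ := exists_nat_gt |v t|
    exact lt_asymm hn (Set.mem_iInter.1 ht n).1
  have hlim := tendsto_measure_iInter_atTop hB hanti
    ⟨0, ne_top_of_le_ne_top hμF (measure_mono Set.inter_subset_right)⟩
  rw [hinter, measure_empty] at hlim
  obtain ⟨n, hn⟩ := (hlim.eventually (gt_mem_nhds (ENNReal.ofReal_pos.2 hδ))).exists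
  -- `B n` is only null-measurable, so a measurable hull of the same measure is removed; `n + 1`
  -- makes the bound positive even when `n = 0`.
  refine ⟨n + 1, by positivity, F \ toMeasurable μ (B n), hF.diff (measurableSet_toMeasurable _ _),
    Set.sdiff_subset, ?_, fun t ht => ?_⟩
  · refine lt_of_le_of_lt (measure_mono ?_) ((measure_toMeasurable (B n)).trans_lt hn)
    intro t ht
    by_contra h
    exact ht.2 ⟨ht.1, h⟩
  · by_contra h
    push Not at h
    exact ht.2 (subset_toMeasurable μ _ ⟨by simp only [Set.mem_ofPred_eq]; linarith, ht.1⟩)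

end General

/-! ### Admissibility as a pointwise bound on the weight -/

section Admissible

variable {G : Type*} [MeasurableSpace G]

variable {μ : Measure G} {ω : G → ℝ} {p : ℝ≥0∞} {f g : G → ℂ}

theorem MemWeightedLp.aestronglyMeasurable (hω : AEMeasurable ω μ) (hpos : ∀ t, 0 < ω t)
    (hf : MemWeightedLp μ p ω f) : AEStronglyMeasurable f μ := by
  have h : f = fun t => (f t * (ω t : ℂ)) * ((ω t : ℂ))⁻¹ := by
    ext t
    have : (ω t : ℂ) ≠ 0 := by exact_mod_cast (hpos t).ne'
    field_simp
  rw [h]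
  exact hf.1.mul (Complex.measurable_ofReal.comp_aemeasurable hω).inv.aestronglyMeasurable

theorem MemWeightedLp.sub (hf : MemWeightedLp μ p ω f) (hg : MemWeightedLp μ p ω g) :
    MemWeightedLp μ p ω (f - g) := by
  have := MemLp.sub hf hg
  unfold MemWeightedLp
  convert this using 1
  ext t
  simp [sub_mul]

theorem MemWeightedLp.add (hf : MemWeightedLp μ p ω f) (hg : MemWeightedLp μ p ω g) :
    MemWeightedLp μ p ω (f + g) := by
  have := MemLp.add hf hg
  unfold MemWeightedLp
  convert this using 1
  ext t
  simp [add_mul]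

theorem weightedNorm_add_le (hp : 1 ≤ p) (hf : MemWeightedLp μ p ω f)
    (hg : MemWeightedLp μ p ω g) :
    weightedNorm μ p ω (f + g) ≤ weightedNorm μ p ω f + weightedNorm μ p ω g := by
  refine le_trans (le_of_eq ?_) (eLpNorm_add_le hf.1 hg.1 hp)
  unfold weightedNorm
  congr 1
  ext t
  simp [add_mul]

theorem translate_eq_comp {G : Type*} [Group G] {ω : G → ℝ} (s : G) (f : G → ℂ) :
    (fun t => f t * (ω (s * t) : ℂ)) = (fun t => translate s f t * (ω t : ℂ)) ∘ (s * ·) := by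
  ext t
  simp [translate]

variable [Group G] [TopologicalSpace G] [IsTopologicalGroup G] [BorelSpace G] [μ.IsHaarMeasure]

/-- Left invariance of the measure shifts the translation from the function onto the weight. -/
theorem weightedNorm_translate (s : G) (f : G → ℂ) :
    weightedNorm μ p ω (translate s f) = eLpNorm (fun t => f t * (ω (s * t) : ℂ)) p μ := by
  rw [translate_eq_comp, ← MeasurableEmbedding.eLpNorm_map_measure (measurableEmbedding_mulLeft s),
    map_mul_left_eq_self]
  rfl

theorem memWeightedLp_translate (s : G) (f : G → ℂ) :
    MemWeightedLp μ p ω (translate s f) ↔ MemLp (fun t => f t * (ω (s * t) : ℂ)) p μ := by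
  rw [translate_eq_comp, ← (measurableEmbedding_mulLeft s).memLp_map_measure_iff,
    map_mul_left_eq_self]
  rfl

theorem aemeasurable_comp_mul_left (hω : AEMeasurable ω μ) (s : G) :
    AEMeasurable (fun t => ω (s * t)) μ :=
  hω.comp_quasiMeasurePreserving (measurePreserving_mul_left μ s).quasiMeasurePreserving

theorem IsAdmissible.ae_le [SecondCountableTopology G] [LocallyCompactSpace G] {S : Set G}
    (h : IsAdmissible μ p ω S)
    (hp : p ≠ 0) (hp_top : p ≠ ∞)
    (hω : AEMeasurable ω μ) (hpos : ∀ t, 0 < ω t) {s : G} (hs : s ∈ S) :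
    ∃ C : ℝ≥0, ∀ᵐ t ∂μ, ω (s * t) ≤ C * ω t := by
  obtain ⟨C, hC⟩ := h s hs
  have hp' : 0 < p.toReal := ENNReal.toReal_pos hp hp_top
  have hωs := aemeasurable_comp_mul_left hω s
  -- The `p`-th powers are compared through their integrals over measurable sets. The constant `max
  -- C 1` is nonzero, so the right side is still infinite when the integral of `ω ^ p` is infinite
  -- and the indicator is not in the space.
  have key : (fun t => ‖ω (s * t)‖ₑ ^ p.toReal) ≤ᵐ[μ]
      fun t => ((max C 1 : ℝ≥0) : ℝ≥0∞) ^ p.toReal * ‖ω t‖ₑ ^ p.toReal := by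
    refine ae_le_of_forall_setLIntegral_le_of_sigmaFinite₀ (hωs.enorm.pow_const _)
      fun A hA _ => ?_
    have hind : ∀ v : G → ℝ, eLpNorm (fun t => A.indicator (1 : G → ℂ) t * (v t : ℂ)) p μ
        = (∫⁻ t in A, ‖v t‖ₑ ^ p.toReal ∂μ) ^ (1 / p.toReal) := by
      intro v
      have : (fun t => A.indicator (1 : G → ℂ) t * (v t : ℂ))
          = A.indicator fun t => (v t : ℂ) := by
        ext t
        by_cases ht : t ∈ A <;> simp [ht]
      rw [this, eLpNorm_indicator_eq_eLpNorm_restrict hA,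
        eLpNorm_eq_lintegral_rpow_enorm_toReal hp hp_top]
      congr 2
      ext t
      rw [← ofReal_norm, ← ofReal_norm, Complex.norm_real]
    have hmul : ∫⁻ t in A, ((max C 1 : ℝ≥0) : ℝ≥0∞) ^ p.toReal * ‖ω t‖ₑ ^ p.toReal ∂μ
        = ((max C 1 : ℝ≥0) : ℝ≥0∞) ^ p.toReal * ∫⁻ t in A, ‖ω t‖ₑ ^ p.toReal ∂μ :=
      lintegral_const_mul'' _ (hω.enorm.pow_const _).restrict
    rw [hmul]
    by_cases htop : ∫⁻ t in A, ‖ω t‖ₑ ^ p.toReal ∂μ = ∞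
    · rw [htop, ENNReal.mul_top]
      · exact le_top
      · exact (ENNReal.rpow_pos (by simp) ENNReal.coe_ne_top).ne'
    have hmem : MemWeightedLp μ p ω (A.indicator 1) := by
      refine ⟨((measurable_one.indicator hA).aemeasurable.mul
        (Complex.measurable_ofReal.comp_aemeasurable hω)).aestronglyMeasurable, ?_⟩
      rw [hind ω]
      exact ENNReal.rpow_lt_top_of_nonneg (by positivity) htop
    have hle := (hC _ hmem).2
    rw [weightedNorm_translate, weightedNorm, hind ω, hind (fun t => ω (s * t))] at hle
    have hle' := ENNReal.rpow_le_rpow hle hp'.le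
    rw [ENNReal.mul_rpow_of_nonneg _ _ hp'.le, ← ENNReal.rpow_mul, ← ENNReal.rpow_mul,
      one_div_mul_cancel hp'.ne', ENNReal.rpow_one, ENNReal.rpow_one] at hle'
    refine hle'.trans ?_
    gcongr
    exact le_max_left _ _
  refine ⟨max C 1, key.mono fun t ht => ?_⟩
  dsimp only at ht
  rw [← ENNReal.mul_rpow_of_nonneg _ _ hp'.le, ENNReal.rpow_le_rpow_iff hp'] at ht
  rw [Real.enorm_eq_ofReal (hpos _).le, Real.enorm_eq_ofReal (hpos _).le,
    ← ENNReal.ofReal_coe_nnreal, ← ENNReal.ofReal_mul (NNReal.coe_nonneg _),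
    ENNReal.ofReal_le_ofReal_iff (by have := hpos t; positivity)] at ht
  exact ht

theorem translate_bounded_of_ae_le (hω : AEMeasurable ω μ) (hpos : ∀ t, 0 < ω t) {s : G}
    {C : ℝ≥0} (hC : ∀ᵐ t ∂μ, ω (s * t) ≤ C * ω t) (hf : MemWeightedLp μ p ω f) :
    MemWeightedLp μ p ω (translate s f) ∧
      weightedNorm μ p ω (translate s f) ≤ C * weightedNorm μ p ω f := by
  have hle : ∀ᵐ t ∂μ, ‖f t * (ω (s * t) : ℂ)‖₊ ≤ C * ‖f t * (ω t : ℂ)‖₊ := by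
    filter_upwards [hC] with t ht
    rw [← NNReal.coe_le_coe]
    push_cast
    simp only [norm_mul, Complex.norm_real, Real.norm_of_nonneg (hpos _).le]
    nlinarith [norm_nonneg (f t)]
  have hnorm := eLpNorm_le_nnreal_smul_eLpNorm_of_ae_le_mul hle p
  rw [memWeightedLp_translate, weightedNorm_translate]
  refine ⟨⟨(hf.aestronglyMeasurable hω hpos).mul (Complex.measurable_ofReal.comp_aemeasurable
    (aemeasurable_comp_mul_left hω s)).aestronglyMeasurable, hnorm.trans_lt ?_⟩, hnorm⟩
  exact ENNReal.mul_lt_top ENNReal.coe_lt_top hf.2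

theorem IsAdmissible.exponent [SecondCountableTopology G] [LocallyCompactSpace G] {S : Set G}
    (h : IsAdmissible μ p ω S)
    (hp : p ≠ 0) (hp_top : p ≠ ∞) (hω : AEMeasurable ω μ) (hpos : ∀ t, 0 < ω t) (q : ℝ≥0∞) :
    IsAdmissible μ q ω S := fun _ hs =>
  let ⟨C, hC⟩ := h.ae_le hp hp_top hω hpos hs
  ⟨C, fun _ hf => translate_bounded_of_ae_le hω hpos hC hf⟩

end Admissible

/-! ### Equivalence of the smallness conditions -/

section Conditions

variable {G : Type*} [Group G] [TopologicalSpace G] [MeasurableSpace G]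
  [IsTopologicalGroup G] [BorelSpace G] [SecondCountableTopology G]
  [LocallyCompactSpace G] {μ : Measure G} [μ.IsHaarMeasure] {ω : G → ℝ} {p : ℝ≥0∞} {S : Set G}

theorem exists_isCompact_subset_measure_diff_lt [T2Space G] {F E₀ : Set G} (hF : IsCompact F)
    (hE₀ : MeasurableSet E₀) (hsub : E₀ ⊆ F) {δ : ℝ≥0∞} (h : μ (F \ E₀) < δ) :
    ∃ E : Set G, IsCompact E ∧ E ⊆ E₀ ∧ μ (F \ E) < δ := by
  have hfin : μ E₀ ≠ ∞ := ne_top_of_le_ne_top hF.measure_lt_top.ne (measure_mono hsub)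
  obtain ⟨E, hE, hEc, hlt⟩ := hE₀.exists_isCompact_sdiff_lt hfin (tsub_pos_iff_lt.2 h).ne'
  refine ⟨E, hEc, hE, ?_⟩
  calc μ (F \ E) ≤ μ (F \ E₀ ∪ E₀ \ E) := measure_mono fun t ht => by
        by_cases h' : t ∈ E₀
        · exact Or.inr ⟨h', ht.2⟩
        · exact Or.inl ⟨ht.1, h'⟩
    _ ≤ μ (F \ E₀) + μ (E₀ \ E) := measure_union_le _ _
    _ < δ := by
      rw [add_comm]; exact lt_tsub_iff_right.1 hlt

theorem EssSupCondition.lpCondition (hpos : ∀ t, 0 < ω t) (h : EssSupCondition μ ω S)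
    (hp : p ≠ 0) (hp_top : p ≠ ∞) : LpCondition μ p ω S := by
  intro F hF δ hδ
  have hp' : 0 < p.toReal := ENNReal.toReal_pos hp hp_top
  have hfin : (2 * μ F) ^ (1 / p.toReal) ≠ ∞ :=
    ENNReal.rpow_ne_top_of_nonneg (by positivity) (ENNReal.mul_ne_top (by simp) hF.measure_ne_top)
  -- `m` bounds the factor `μ (sE ∪ s⁻¹E) ^ (1 / p)`; dividing by `m + 1` covers `m = 0` and makes
  -- the final inequality strict.
  set m : ℝ := ((2 * μ F) ^ (1 / p.toReal)).toReal with hm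
  have hm0 : 0 ≤ m := ENNReal.toReal_nonneg
  have hδ' : 0 < δ / (m + 1) := by positivity
  obtain ⟨s, hs, E, hE, hEF, hμ, hsup⟩ := h F hF (min δ (δ / (m + 1))) (lt_min hδ hδ')
  refine ⟨s, hs, E, hE, hEF, hμ.trans_le (ENNReal.ofReal_le_ofReal (min_le_left _ _)), ?_⟩
  have hbd : ∀ᵐ t ∂μ.restrict (s • E ∪ s⁻¹ • E), ‖ω t‖ ≤ δ / (m + 1) := by
    filter_upwards [ae_lt_of_essSup_lt hsup] with t ht
    rw [Real.norm_of_nonneg (hpos t).le]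
    exact ((ENNReal.ofReal_lt_ofReal_iff (lt_min hδ hδ')).1 ht).le.trans (min_le_right _ _)
  refine (eLpNorm_le_of_ae_bound hbd).trans_lt ?_
  have hvol : μ (s • E ∪ s⁻¹ • E) ≤ 2 * μ F := by
    refine (measure_union_le _ _).trans ?_
    rw [measure_smul, measure_smul, two_mul]
    gcongr
  rw [Measure.restrict_apply_univ, ← one_div p.toReal]
  calc μ (s • E ∪ s⁻¹ • E) ^ (1 / p.toReal) * ENNReal.ofReal (δ / (m + 1))
      ≤ (2 * μ F) ^ (1 / p.toReal) * ENNReal.ofReal (δ / (m + 1)) := by gcongr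
    _ = ENNReal.ofReal (m * (δ / (m + 1))) := by
      rw [ENNReal.ofReal_mul hm0, hm, ENNReal.ofReal_toReal hfin]
    _ < ENNReal.ofReal δ := by
      rw [ENNReal.ofReal_lt_ofReal_iff hδ, mul_div_assoc', div_lt_iff₀ (by positivity)]
      linarith [mul_comm m δ]

theorem LpCondition.essSupCondition [T2Space G] (hω : AEMeasurable ω μ) (hpos : ∀ t, 0 < ω t)
    (h : LpCondition μ p ω S) (hp : p ≠ 0) (hp_top : p ≠ ∞) : EssSupCondition μ ω S := by
  intro F hF δ hδ
  have hc : 0 < δ / 2 := by positivity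
  have hη : 0 < δ / 8 := by positivity
  obtain ⟨s, hs, E, hE, hEF, hμ, hnorm⟩ := h F hF
    (min (δ / 8) (δ / 2 * (δ / 8) ^ (1 / p.toReal))) (lt_min hη (by positivity))
  have hmeas : MeasurableSet (s • E ∪ s⁻¹ • E) :=
    (hE.smul s).measurableSet.union (hE.smul s⁻¹).measurableSet
  rw [← eLpNorm_indicator_eq_eLpNorm_restrict hmeas] at hnorm
  have hB := measure_le_of_eLpNorm_le hp hp_top
    (hω.aestronglyMeasurable.indicator hmeas) hc hη
    (hnorm.le.trans (ENNReal.ofReal_le_ofReal (min_le_right _ _)))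
  set B := {t | δ / 2 ≤ ‖(s • E ∪ s⁻¹ • E).indicator ω t‖} with hBdef
  set B' := toMeasurable μ B
  have hB'm : MeasurableSet B' := measurableSet_toMeasurable _ _
  have hB' : μ B' ≤ ENNReal.ofReal (δ / 8) := (measure_toMeasurable B).trans_le hB
  -- A point `e` is kept only if neither `s * e` nor `s⁻¹ * e` lies in the bad set `B'`. Both
  -- translates of `B'` have its measure, so at most `3δ/8` is lost.
  have hlt : μ (F \ (E \ (s⁻¹ • B' ∪ s • B'))) < ENNReal.ofReal δ := by
    calc μ (F \ (E \ (s⁻¹ • B' ∪ s • B'))) ≤ μ (F \ E ∪ (s⁻¹ • B' ∪ s • B')) :=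
          measure_mono fun t ht => by
            by_cases h' : t ∈ E
            · exact Or.inr (by by_contra h''; exact ht.2 ⟨h', h''⟩)
            · exact Or.inl ⟨ht.1, h'⟩
      _ ≤ μ (F \ E) + (μ (s⁻¹ • B') + μ (s • B')) :=
          (measure_union_le _ _).trans (by gcongr; exact measure_union_le _ _)
      _ ≤ ENNReal.ofReal (δ / 8) + (ENNReal.ofReal (δ / 8) + ENNReal.ofReal (δ / 8)) := by
          rw [measure_smul, measure_smul]
          gcongr
          exact hμ.le.trans (ENNReal.ofReal_le_ofReal (min_le_left _ _))
      _ < ENNReal.ofReal δ := by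
          rw [← ENNReal.ofReal_add hη.le hη.le, ← ENNReal.ofReal_add hη.le (by positivity),
            ENNReal.ofReal_lt_ofReal_iff hδ]
          linarith
  obtain ⟨E', hE', hsub, hμ'⟩ := exists_isCompact_subset_measure_diff_lt hF
    (hE.measurableSet.diff ((hB'm.const_smul _).union (hB'm.const_smul _)))
    (Set.sdiff_subset.trans hEF) hlt
  refine ⟨s, hs, E', hE', hsub.trans (Set.sdiff_subset.trans hEF), hμ', ?_⟩
  have hmeas' : MeasurableSet (s • E' ∪ s⁻¹ • E') :=
    (hE'.smul s).measurableSet.union (hE'.smul s⁻¹).measurableSet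
  refine lt_of_le_of_lt (essSup_le_of_ae_le (ENNReal.ofReal (δ / 2)) ?_)
    ((ENNReal.ofReal_lt_ofReal_iff hδ).2 (by linarith))
  refine (ae_restrict_iff' hmeas').2 (Filter.Eventually.of_forall fun t ht => ?_)
  refine ENNReal.ofReal_le_ofReal ?_
  have htB : t ∉ B' := by
    rcases ht with ⟨e, he, rfl⟩ | ⟨e, he, rfl⟩
    · exact fun hb => (hsub he).2 (Or.inl ⟨_, hb, by simp⟩)
    · exact fun hb => (hsub he).2 (Or.inr ⟨_, hb, by simp⟩)
  have htE : t ∈ s • E ∪ s⁻¹ • E := by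
    rcases ht with ⟨e, he, rfl⟩ | ⟨e, he, rfl⟩
    · exact Or.inl ⟨e, (hsub he).1, rfl⟩
    · exact Or.inr ⟨e, (hsub he).1, rfl⟩
  by_contra hlt'
  push Not at hlt'
  refine htB (subset_toMeasurable μ B ?_)
  simp only [hBdef, Set.mem_ofPred_eq, Set.indicator_of_mem htE]
  rw [Real.norm_of_nonneg (hpos t).le]
  exact hlt'.le

end Conditions

/-! ### From a dense vector to smallness of the weight -/

section Necessity

theorem memLp_indicator_const_mul {α : Type*} [MeasurableSpace α] {μ : Measure α} {p : ℝ≥0∞}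
    {A : Set α} (hA : MeasurableSet A)
    (hμA : μ A ≠ ∞) {v : α → ℝ} (hv : AEMeasurable v μ) {M : ℝ} (hM : ∀ t ∈ A, |v t| ≤ M) (c : ℂ) :
    MemLp (fun t => A.indicator (fun _ => c) t * (v t : ℂ)) p μ := by
  have heq : (fun t => A.indicator (fun _ => c) t * (v t : ℂ))
      = A.indicator fun t => c * (v t : ℂ) := by
    ext t
    by_cases ht : t ∈ A <;> simp [ht]
  rw [heq, memLp_indicator_iff_restrict hA]
  have : IsFiniteMeasure (μ.restrict A) := ⟨by simpa using hμA.lt_top⟩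
  refine MemLp.of_bound ((Complex.measurable_ofReal.comp_aemeasurable hv).const_mul
    c).aestronglyMeasurable.restrict (‖c‖ * M) ?_
  refine (ae_restrict_iff' hA).2 (Filter.Eventually.of_forall fun t ht => ?_)
  rw [norm_mul, Complex.norm_real]
  exact mul_le_mul_of_nonneg_left (hM t ht) (norm_nonneg _)

/-- If `h` is close to `1` on `F₀` and to `0` elsewhere, while its translate `k` is close to `3` on
`F₁ ⊆ F₀` and to `0` elsewhere, then `s` and `s⁻¹` move almost all of `F₁` to places where `ω` is
dominated by the two approximation errors. -/
theorem weight_le_of_translate_approx {G : Type*} [Group G] {ω : G → ℝ} {h : G → ℂ} {s : G}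
    {F₀ F₁ E : Set G} (hF : F₁ ⊆ F₀)
    (hpos : ∀ t, 0 < ω t) {M : ℝ} (hM : ∀ t ∈ F₀, (ω t)⁻¹ ≤ M) (hM0 : 0 < M)
    (hEF : E ⊆ F₁)
    (h₁ : ∀ t ∈ s⁻¹ • E ∪ E, ‖(h t - F₀.indicator (fun _ => 1) t) * (ω t : ℂ)‖ < 1 / (2 * M))
    (h₂ : ∀ t ∈ s • E ∪ E,
      ‖(translate s h t - F₁.indicator (fun _ => 3) t) * (ω t : ℂ)‖ < 1 / (2 * M)) :
    ∀ t ∈ s • E ∪ s⁻¹ • E, ω t ≤ 2 * (‖(h t - F₀.indicator (fun _ => 1) t) * (ω t : ℂ)‖ +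
      ‖(translate s h t - F₁.indicator (fun _ => 3) t) * (ω t : ℂ)‖) := by
  -- On `F₀` the weight is at least `1 / M`, so a weighted error below `1 / (2 * M)` is a true error
  -- below `1 / 2`.
  have hsmall : ∀ (t : G) (z : ℂ), t ∈ F₀ → ‖z * (ω t : ℂ)‖ < 1 / (2 * M) → ‖z‖ < 1 / 2 := by
    intro t z ht hz
    rw [norm_mul, Complex.norm_real, Real.norm_of_nonneg (hpos t).le] at hz
    have h1 := hM t ht
    have h2 : 1 ≤ M * ω t := by
      rwa [inv_eq_one_div, div_le_iff₀ (hpos t)] at h1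
    rw [lt_div_iff₀ (by positivity)] at hz
    nlinarith [norm_nonneg z]
  have hfar : ∀ z : ℂ, ‖z - 1‖ < 1 / 2 → ‖z - 3‖ < 1 / 2 → False := by
    intro z hz1 hz3
    have : ‖(3 - 1 : ℂ)‖ ≤ ‖z - 1‖ + ‖z - 3‖ := by
      calc ‖(3 - 1 : ℂ)‖ = ‖(z - 1) - (z - 3)‖ := by congr 1; ring
        _ ≤ _ := norm_sub_le _ _
    norm_num at this
    linarith
  have hbig : ∀ (z a : ℂ), 1 ≤ ‖a‖ → ‖z - a‖ < 1 / 2 → 1 / 2 ≤ ‖z‖ := by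
    intro z a ha hz
    have := norm_sub_norm_le a z
    rw [norm_sub_rev] at this
    linarith
  have hω : ∀ (t : G) (z : ℂ), 1 / 2 ≤ ‖z‖ → ω t ≤ 2 * ‖z * (ω t : ℂ)‖ := by
    intro t z hz
    rw [norm_mul, Complex.norm_real, Real.norm_of_nonneg (hpos t).le]
    nlinarith [hpos t]
  rintro t (⟨e, he, rfl⟩ | ⟨e, he, rfl⟩)
  · have hte : translate s h (s * e) = h e := by simp [translate]
    have h1 := hsmall e _ (hF (hEF he)) (h₁ e (Or.inr he))
    rw [Set.indicator_of_mem (hF (hEF he))] at h1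
    have hnot : s * e ∉ F₁ := fun hmem => by
      have h2 := hsmall _ _ (hF hmem) (h₂ _ (Or.inl ⟨e, he, rfl⟩))
      rw [Set.indicator_of_mem hmem, hte] at h2
      exact hfar _ h1 h2
    have h3 : 1 / 2 ≤ ‖translate s h (s * e) - F₁.indicator (fun _ => 3) (s * e)‖ := by
      rw [Set.indicator_of_notMem hnot, sub_zero, hte]
      exact hbig _ 1 (by simp) h1
    have := hω (s * e) _ h3
    simp only [smul_eq_mul]
    linarith [norm_nonneg ((h (s * e) - F₀.indicator (fun _ => 1) (s * e)) * (ω (s * e) : ℂ))]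
  · have h1 := hsmall e _ (hF (hEF he)) (h₂ e (Or.inr he))
    rw [Set.indicator_of_mem (hEF he)] at h1
    have hnot : s⁻¹ * e ∉ F₀ := fun hmem => by
      have h2 := hsmall _ _ hmem (h₁ _ (Or.inl ⟨e, he, rfl⟩))
      rw [Set.indicator_of_mem hmem] at h2
      exact hfar _ h2 h1
    have h3 : 1 / 2 ≤ ‖h (s⁻¹ * e) - F₀.indicator (fun _ => 1) (s⁻¹ * e)‖ := by
      rw [Set.indicator_of_notMem hnot, sub_zero]
      exact hbig _ 3 (by norm_num) h1
    have := hω (s⁻¹ * e) _ h3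
    simp only [smul_eq_mul]
    linarith [norm_nonneg ((translate s h (s⁻¹ * e) - F₁.indicator (fun _ => 3) (s⁻¹ * e)) *
      (ω (s⁻¹ * e) : ℂ))]

variable {G : Type*} [Group G] [MeasurableSpace G] {μ : Measure G} {ω : G → ℝ} {p : ℝ≥0∞}
  {S : Set G}

/-- A dense orbit of a commuting family contains, next to any vector of the orbit, approximations
of every vector by a further translate of it. -/
theorem IsDenseVector.exists_translate_translate (hS : ∀ s ∈ S, ∀ t ∈ S, s * t = t * s)
    (hadm : IsAdmissible μ p ω S) {f : G → ℂ} (hf : IsDenseVector μ p ω S f) {r : G} (hr : r ∈ S)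
    {g : G → ℂ} (hg : MemWeightedLp μ p ω (translate r⁻¹ g)) {ε : ℝ} (hε : 0 < ε) :
    ∃ s ∈ S, MemWeightedLp μ p ω (translate s (translate r f) - g) ∧
      weightedNorm μ p ω (translate s (translate r f) - g) < ENNReal.ofReal ε := by
  obtain ⟨C, hC⟩ := hadm r hr
  obtain ⟨s, hs, hlt⟩ := hf.2.2 _ hg (ε / (C + 1)) (by positivity)
  -- Commutativity pulls out `T_r`, whose bound `C` accounts for the tolerance `ε / (C + 1)`.
  have heq : translate s (translate r f) - g
      = translate r (translate s f - translate r⁻¹ g) := by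
    ext t
    simp only [translate, Pi.sub_apply, inv_inv, ← mul_assoc, ← mul_inv_rev, mul_inv_cancel,
      one_mul, hS s hs r hr]
  obtain ⟨hmem, hle⟩ := hC _ ((hf.2.1 s hs).sub hg)
  refine ⟨s, hs, heq ▸ hmem, heq ▸ hle.trans_lt ?_⟩
  calc (C : ℝ≥0∞) * weightedNorm μ p ω (translate s f - translate r⁻¹ g)
      ≤ C * ENNReal.ofReal (ε / (C + 1)) := by gcongr
    _ = ENNReal.ofReal (C * (ε / (C + 1))) := by
      rw [ENNReal.ofReal_mul C.coe_nonneg, ENNReal.ofReal_coe_nnreal]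
    _ < ENNReal.ofReal ε := by
      rw [ENNReal.ofReal_lt_ofReal_iff hε, mul_div_assoc', div_lt_iff₀ (by positivity)]
      linarith [mul_comm (C : ℝ) ε]

variable [TopologicalSpace G] [IsTopologicalGroup G] [BorelSpace G] [SecondCountableTopology G] [T2Space G]
  [LocallyCompactSpace G] [μ.IsHaarMeasure]

theorem IsDenseVector.lpCondition (hS : ∀ s ∈ S, ∀ t ∈ S, s * t = t * s) (hp : 1 ≤ p)
    (hp_top : p ≠ ∞) (hω : AEMeasurable ω μ) (hpos : ∀ t, 0 < ω t) (hadm : IsAdmissible μ p ω S)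
    {f : G → ℂ} (hf : IsDenseVector μ p ω S f) : LpCondition μ p ω S := by
  intro F hF δ hδ
  have hp0 : p ≠ 0 := (zero_lt_one.trans_le hp).ne'
  have hη : 0 < δ / 8 := by positivity
  -- Bounding `ω + ω⁻¹` bounds both positive summands at once.
  obtain ⟨M, hM0, F₀, hF₀, hF₀F, hμF₀, hM⟩ := exists_bounded_on_subset
    (hω.add hω.inv) hF.measurableSet hF.measure_ne_top hη
  have hMinv : ∀ t ∈ F₀, (ω t)⁻¹ ≤ M := fun t ht => by
    have := (le_abs_self _).trans (hM t ht)
    simp only [Pi.add_apply, Pi.inv_apply] at this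
    linarith [hpos t]
  have hMω : ∀ t ∈ F₀, |ω t| ≤ M := fun t ht => by
    have := (le_abs_self _).trans (hM t ht)
    simp only [Pi.add_apply, Pi.inv_apply] at this
    rw [abs_of_pos (hpos t)]
    linarith [inv_pos.2 (hpos t)]
  have hfin₀ : μ F₀ ≠ ∞ := ne_top_of_le_ne_top hF.measure_ne_top (measure_mono hF₀F)
  have hc : 0 < 1 / (2 * M) := by positivity
  -- The first term yields the final estimate `4ε < δ`; the second makes Chebyshev at level `1 / (2
  -- * M)` give exceptional sets of measure at most `δ / 8`.
  set ε : ℝ := min (δ / 8) (1 / (2 * M) * (δ / 8) ^ (1 / p.toReal))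
  have hε : 0 < ε := lt_min hη (by positivity)
  have hχ : MemWeightedLp μ p ω (F₀.indicator fun _ => 1) :=
    memLp_indicator_const_mul hF₀ hfin₀ hω hMω 1
  obtain ⟨r, hr, hrlt⟩ := hf.2.2 _ hχ ε hε
  -- `r⁻¹` need not belong to `S`, and `ω` need not be locally `p`-summable. Bounding `ω (r⁻¹ * t)`
  -- on `F₁` puts the `r⁻¹`-translate of the second target in the space.
  obtain ⟨M', -, F₁, hF₁, hF₁F, hμF₁, hM'⟩ := exists_bounded_on_subset
    (aemeasurable_comp_mul_left hω r⁻¹) hF₀ hfin₀ hη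
  have hfin₁ : μ F₁ ≠ ∞ := ne_top_of_le_ne_top hfin₀ (measure_mono hF₁F)
  have hg : MemWeightedLp μ p ω (translate r⁻¹ (F₁.indicator fun _ => 3)) :=
    (memWeightedLp_translate _ _).2 (memLp_indicator_const_mul hF₁ hfin₁
      (aemeasurable_comp_mul_left hω r⁻¹) hM' 3)
  obtain ⟨s, hs, hsmem, hslt⟩ := hf.exists_translate_translate hS hadm hr hg hε
  have hrmem := (hf.2.1 r hr).sub hχ
  set h := translate r f
  set a : G → ℂ := fun t => (h t - F₀.indicator (fun _ => 1) t) * (ω t : ℂ)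
  set b : G → ℂ := fun t => (translate s h t - F₁.indicator (fun _ => 3) t) * (ω t : ℂ)
  have ha : MemLp a p μ := hrmem
  have hb : MemLp b p μ := hsmem
  have haε : eLpNorm a p μ ≤ ENNReal.ofReal ε := hrlt.le
  have hbε : eLpNorm b p μ ≤ ENNReal.ofReal ε := hslt.le
  have hA := measure_le_of_eLpNorm_le hp0 hp_top ha.1 hc hη
    (haε.trans (ENNReal.ofReal_le_ofReal (min_le_right _ _)))
  have hB := measure_le_of_eLpNorm_le hp0 hp_top hb.1 hc hη
    (hbε.trans (ENNReal.ofReal_le_ofReal (min_le_right _ _)))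
  rw [← measure_toMeasurable] at hA hB
  set A := toMeasurable μ {t | 1 / (2 * M) ≤ ‖a t‖}
  set B := toMeasurable μ {t | 1 / (2 * M) ≤ ‖b t‖}
  have hAm : MeasurableSet A := measurableSet_toMeasurable _ _
  have hBm : MeasurableSet B := measurableSet_toMeasurable _ _
  have haA : ∀ t, t ∉ A → ‖a t‖ < 1 / (2 * M) := fun t ht => by
    by_contra hcon
    exact ht (subset_toMeasurable μ _ (not_lt.1 hcon))
  have hbB : ∀ t, t ∉ B → ‖b t‖ < 1 / (2 * M) := fun t ht => by
    by_contra hcon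
    exact ht (subset_toMeasurable μ _ (not_lt.1 hcon))
  -- Off `N`, the error `a` is small at `e` and `s⁻¹ * e`, and `b` is small at `e` and `s * e`. With
  -- `F \ F₀` and `F₀ \ F₁` the loss is at most `6δ/8`.
  set N : Set G := (A ∪ B) ∪ (s • A ∪ s⁻¹ • B)
  have hNm : MeasurableSet N :=
    (hAm.union hBm).union ((hAm.const_smul _).union (hBm.const_smul _))
  have hlt : μ (F \ (F₁ \ N)) < ENNReal.ofReal δ := by
    calc μ (F \ (F₁ \ N)) ≤ μ ((F \ F₀ ∪ F₀ \ F₁) ∪ N) := measure_mono fun t ht => by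
          by_cases h0 : t ∈ F₀
          · by_cases h1 : t ∈ F₁
            · exact Or.inr (by by_contra h''; exact ht.2 ⟨h1, h''⟩)
            · exact Or.inl (Or.inr ⟨h0, h1⟩)
          · exact Or.inl (Or.inl ⟨ht.1, h0⟩)
      _ ≤ (μ (F \ F₀) + μ (F₀ \ F₁)) + ((μ A + μ B) + (μ (s • A) + μ (s⁻¹ • B))) := by
          refine (measure_union_le _ _).trans (add_le_add (measure_union_le _ _) ?_)
          exact (measure_union_le _ _).trans
            (add_le_add (measure_union_le _ _) (measure_union_le _ _))
      _ ≤ (ENNReal.ofReal (δ / 8) + ENNReal.ofReal (δ / 8)) +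
            ((ENNReal.ofReal (δ / 8) + ENNReal.ofReal (δ / 8)) +
              (ENNReal.ofReal (δ / 8) + ENNReal.ofReal (δ / 8))) := by
          rw [measure_smul, measure_smul]
          gcongr
      _ < ENNReal.ofReal δ := by
          rw [← ENNReal.ofReal_add hη.le hη.le, ← ENNReal.ofReal_add (by positivity) (by positivity),
            ← ENNReal.ofReal_add (by positivity) (by positivity), ENNReal.ofReal_lt_ofReal_iff hδ]
          linarith
  obtain ⟨E, hE, hEsub, hμE⟩ := exists_isCompact_subset_measure_diff_lt hF (hF₁.diff hNm)
    (Set.sdiff_subset.trans (hF₁F.trans hF₀F)) hlt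
  have hEF₁ : E ⊆ F₁ := hEsub.trans Set.sdiff_subset
  refine ⟨s, hs, E, hE, hEF₁.trans (hF₁F.trans hF₀F), hμE, ?_⟩
  have hD : MeasurableSet (s • E ∪ s⁻¹ • E) :=
    (hE.smul s).measurableSet.union (hE.smul s⁻¹).measurableSet
  have hle := weight_le_of_translate_approx (h := h) (s := s) hF₁F hpos hMinv hM0 hEF₁
    (fun t ht => haA t fun htA => by
      rcases ht with ⟨e, he, rfl⟩ | ht
      · exact (hEsub he).2 (Or.inr (Or.inl ⟨_, htA, by simp⟩))
      · exact (hEsub ht).2 (Or.inl (Or.inl htA)))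
    (fun t ht => hbB t fun htB => by
      rcases ht with ⟨e, he, rfl⟩ | ht
      · exact (hEsub he).2 (Or.inr (Or.inr ⟨_, htB, by simp⟩))
      · exact (hEsub ht).2 (Or.inl (Or.inr htB)))
  calc eLpNorm ω p (μ.restrict (s • E ∪ s⁻¹ • E))
      ≤ eLpNorm ((2 : ℝ) • ((fun t => ‖a t‖) + fun t => ‖b t‖)) p
          (μ.restrict (s • E ∪ s⁻¹ • E)) :=
        eLpNorm_mono_ae_real ((ae_restrict_iff' hD).2 (Filter.Eventually.of_forall fun t ht => by
          rw [Real.norm_of_nonneg (hpos t).le]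
          exact hle t ht))
    _ ≤ eLpNorm ((2 : ℝ) • ((fun t => ‖a t‖) + fun t => ‖b t‖)) p μ :=
        eLpNorm_mono_measure _ Measure.restrict_le_self
    _ ≤ ENNReal.ofReal 2 * (ENNReal.ofReal ε + ENNReal.ofReal ε) := by
        rw [eLpNorm_const_smul, Real.enorm_eq_ofReal (by norm_num)]
        gcongr
        refine (eLpNorm_add_le ha.1.norm hb.1.norm hp).trans ?_
        rw [eLpNorm_norm, eLpNorm_norm]
        gcongr
    _ < ENNReal.ofReal δ := by
        rw [← ENNReal.ofReal_add hε.le hε.le, ← ENNReal.ofReal_mul (by norm_num),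
          ENNReal.ofReal_lt_ofReal_iff hδ]
        have : ε ≤ δ / 8 := min_le_left _ _
        linarith

end Necessity

/-! ### Transitivity of the translations -/

section Sufficiency

variable {G : Type*} [MeasurableSpace G] {μ : Measure G} {ω : G → ℝ} {p : ℝ≥0∞} {S : Set G}

theorem weightedNorm_congr_ae {f g : G → ℂ} (h : f =ᵐ[μ] g) :
    weightedNorm μ p ω f = weightedNorm μ p ω g :=
  eLpNorm_congr_ae (h.mono fun t ht => by simp only [ht])

theorem weightedNorm_le_of_bounded_of_support {w : G → ℂ} {M : ℝ} (hw : ∀ t, ‖w t‖ ≤ M) {D : Set G}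
    (hD : MeasurableSet D) (hsupp : ∀ t ∉ D, w t = 0) :
    weightedNorm μ p ω w ≤ ENNReal.ofReal M * eLpNorm ω p (μ.restrict D) := by
  rw [← eLpNorm_indicator_eq_eLpNorm_restrict hD]
  refine eLpNorm_le_mul_eLpNorm_of_ae_le_mul (Filter.Eventually.of_forall fun t => ?_) p
  by_cases ht : t ∈ D
  · rw [Set.indicator_of_mem ht, norm_mul, Complex.norm_real]
    exact mul_le_mul_of_nonneg_right (hw t) (norm_nonneg _)
  · simp [hsupp t ht, ht]

theorem weightedNorm_sub_indicator_le {u : G → ℂ} {F E : Set G} {η : ℝ≥0∞}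
    (hu : ∀ t ∉ F, u t = 0)
    (h : eLpNorm ((F \ E).indicator fun t => u t * (ω t : ℂ)) p μ ≤ η) :
    weightedNorm μ p ω (E.indicator u - u) ≤ η := by
  refine le_trans (eLpNorm_mono fun t => ?_) h
  by_cases hE : t ∈ E
  · simp [hE]
  · by_cases hF : t ∈ F
    · simp [hE, hF]
    · simp [hE, hF, hu t hF]

variable [TopologicalSpace G] [BorelSpace G] [T2Space G]

/-- Bounded functions with compact support are dense in the weighted space, although the weight
need not be locally `p`-summable. -/
theorem MemWeightedLp.exists_bounded_compact_support [LocallyCompactSpace G] [NormalSpace G]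
    [μ.Regular] (hp : 1 ≤ p) (hp_top : p ≠ ∞)
    (hω : AEMeasurable ω μ) (hpos : ∀ t, 0 < ω t) {f : G → ℂ} (hf : MemWeightedLp μ p ω f)
    {ε : ℝ} (hε : 0 < ε) :
    ∃ (u : G → ℂ) (M : ℝ) (K : Set G), 0 < M ∧ IsCompact K ∧ (∀ t, ‖u t‖ ≤ M) ∧
      (∀ t ∉ K, u t = 0) ∧ MemWeightedLp μ p ω u ∧
      weightedNorm μ p ω (u - f) ≤ ENNReal.ofReal ε := by
  obtain ⟨g, hgs, hgε, hgc, hgm⟩ := MemLp.exists_hasCompactSupport_eLpNorm_sub_le hp_top hf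
    (ε := ENNReal.ofReal (ε / 2)) (by simpa using hε)
  obtain ⟨B, hB⟩ := hgs.exists_bound_of_continuous hgc
  obtain ⟨δ, hδ, hδε⟩ := hgm.eLpNorm_indicator_le hp hp_top (half_pos hε)
  have hK : IsCompact (tsupport g) := hgs
  -- Dividing the approximant `g` of `f ω` by `ω` may be unbounded, so it is cut to a set where
  -- `ω⁻¹` is bounded; absolute continuity of the norm of `g` makes the lost part small.
  obtain ⟨M, hM0, K', hK', hK'K, hμ, hM⟩ := exists_bounded_on_subset hω.inv hK.measurableSet
    hK.measure_ne_top hδ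
  have hne : ∀ t, (ω t : ℂ) ≠ 0 := fun t => by exact_mod_cast (hpos t).ne'
  have hgK : ∀ t, t ∉ tsupport g → g t = 0 := fun t ht => image_eq_zero_of_notMem_tsupport ht
  have huω : ∀ t, K'.indicator (fun t => g t * (ω t : ℂ)⁻¹) t * (ω t : ℂ) = K'.indicator g t := by
    intro t
    by_cases ht : t ∈ K'
    · simp [ht, hne t]
    · simp [ht]
  have hmem : MemWeightedLp μ p ω (K'.indicator fun t => g t * (ω t : ℂ)⁻¹) := by
    unfold MemWeightedLp
    simp only [huω]
    exact hgm.indicator hK'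
  refine ⟨K'.indicator fun t => g t * (ω t : ℂ)⁻¹, |B| * M + 1, tsupport g, by positivity, hK,
    fun t => ?_, fun t ht => ?_, hmem, ?_⟩
  · by_cases ht : t ∈ K'
    · rw [Set.indicator_of_mem ht, norm_mul, norm_inv, Complex.norm_real, ← norm_inv]
      have h1 : ‖g t‖ ≤ |B| := (hB t).trans (le_abs_self B)
      have h2 : ‖(ω t)⁻¹‖ ≤ M := hM t ht
      have := mul_le_mul h1 h2 (norm_nonneg _) (abs_nonneg B)
      linarith
    · rw [Set.indicator_of_notMem ht, norm_zero]
      positivity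
  · exact Set.indicator_of_notMem (fun h => ht (hK'K h)) _
  · have heq : (fun t => (K'.indicator (fun t => g t * (ω t : ℂ)⁻¹) - f) t * (ω t : ℂ))
        = (g - fun t => f t * (ω t : ℂ)) - (tsupport g \ K').indicator g := by
      ext t
      simp only [Pi.sub_apply, sub_mul, huω]
      by_cases ht : t ∈ K'
      · simp [ht]
      · by_cases ht' : t ∈ tsupport g
        · simp [ht, ht']
        · simp [ht, ht', hgK t ht']
    have hdiff := hK.measurableSet.diff hK'
    unfold weightedNorm
    rw [heq]
    refine (eLpNorm_sub_le (hgm.1.sub hf.1) (hgm.indicator hdiff).1 hp).trans ?_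
    rw [eLpNorm_sub_comm]
    refine (add_le_add hgε (hδε _ hdiff hμ.le)).trans ?_
    rw [← ENNReal.ofReal_add (by positivity) (by positivity), add_halves]

variable [Group G] [IsTopologicalGroup G]

theorem translate_indicator_bound {u : G → ℂ} {M : ℝ} (hM : 0 ≤ M) (hu : ∀ t, ‖u t‖ ≤ M)
    {E : Set G} (hE : IsCompact E) (s : G) :
    weightedNorm μ p ω (translate s (E.indicator u)) ≤
      ENNReal.ofReal M * eLpNorm ω p (μ.restrict (s • E)) := by
  refine weightedNorm_le_of_bounded_of_support (fun t => ?_) (hE.smul s).measurableSet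
    fun t ht => ?_
  · simp only [translate]
    by_cases h : s⁻¹ * t ∈ E
    · rw [Set.indicator_of_mem h]; exact hu _
    · rw [Set.indicator_of_notMem h, norm_zero]; exact hM
  · exact Set.indicator_of_notMem (fun h => ht ⟨_, h, by simp⟩) _

variable [SecondCountableTopology G] [LocallyCompactSpace G] [μ.IsHaarMeasure]

/-- The family of translations is topologically transitive on the weighted space. -/
theorem LpCondition.exists_translate_approx (hp : 1 ≤ p) (hp_top : p ≠ ∞)
    (hω : AEMeasurable ω μ) (hpos : ∀ t, 0 < ω t) (hadm : IsAdmissible μ p ω S)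
    (h : LpCondition μ p ω S) {f g : G → ℂ} (hf : MemWeightedLp μ p ω f)
    (hg : MemWeightedLp μ p ω g) {ε : ℝ} (hε : 0 < ε) :
    ∃ s ∈ S, ∃ x : G → ℂ, MemWeightedLp μ p ω x ∧
      weightedNorm μ p ω (x - f) < ENNReal.ofReal ε ∧
      weightedNorm μ p ω (translate s x - g) < ENNReal.ofReal ε := by
  have hη : 0 < ε / 4 := by positivity
  obtain ⟨u, M, K, hM, hK, huM, huK, hu, huf⟩ :=
    hf.exists_bounded_compact_support hp hp_top hω hpos hη
  obtain ⟨v, M', K', hM', hK', hvM, hvK, hv, hvg⟩ :=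
    hg.exists_bounded_compact_support hp hp_top hω hpos hη
  obtain ⟨δ₁, hδ₁, hu'⟩ := MemLp.eLpNorm_indicator_le hp hp_top hu hη
  obtain ⟨δ₂, hδ₂, hv'⟩ := MemLp.eLpNorm_indicator_le hp hp_top hv hη
  -- `δ₁` and `δ₂` control cutting `u` and `v` down to `E`; the other two terms control their
  -- translates, of sup norm at most `M` and `M'`.
  set δ : ℝ := min (min δ₁ δ₂) (min (ε / 4 / M) (ε / 4 / M'))
  have hδ : 0 < δ := by positivity
  have hδ1 : δ ≤ δ₁ := (min_le_left _ _).trans (min_le_left _ _)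
  have hδ2 : δ ≤ δ₂ := (min_le_left _ _).trans (min_le_right _ _)
  have hδ3 : M * δ ≤ ε / 4 := by
    have : δ ≤ ε / 4 / M := (min_le_right _ _).trans (min_le_left _ _)
    rwa [le_div_iff₀ hM, mul_comm] at this
  have hδ4 : M' * δ ≤ ε / 4 := by
    have : δ ≤ ε / 4 / M' := (min_le_right _ _).trans (min_le_right _ _)
    rwa [le_div_iff₀ hM', mul_comm] at this
  obtain ⟨s, hs, E, hE, hEF, hμ, hnorm⟩ := h (K ∪ K') (hK.union hK') δ hδ
  have hdiff := (hK.union hK').measurableSet.diff hE.measurableSet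
  have huE : MemWeightedLp μ p ω (E.indicator u) := by
    have := MemLp.indicator hE.measurableSet hu
    unfold MemWeightedLp
    convert this using 2 with t
    by_cases ht : t ∈ E <;> simp [ht]
  have hvE : AEStronglyMeasurable (E.indicator v) μ :=
    (hv.aestronglyMeasurable hω hpos).indicator hE.measurableSet
  have hbound : ∀ {w : G → ℂ} {L : ℝ} {r : G}, 0 < L → (∀ t, ‖w t‖ ≤ L) → L * δ ≤ ε / 4 →
      r • E ⊆ s • E ∪ s⁻¹ • E →
      weightedNorm μ p ω (translate r (E.indicator w)) ≤ ENNReal.ofReal (ε / 4) := by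
    intro w L r hL hw hLδ hsub
    refine (translate_indicator_bound hL.le hw hE r).trans ?_
    calc ENNReal.ofReal L * eLpNorm ω p (μ.restrict (r • E))
        ≤ ENNReal.ofReal L * ENNReal.ofReal δ := by
          gcongr
          exact (eLpNorm_mono_measure _ (Measure.restrict_mono_set μ hsub)).trans hnorm.le
      _ ≤ ENNReal.ofReal (ε / 4) := by
          rw [← ENNReal.ofReal_mul hL.le]
          exact ENNReal.ofReal_le_ofReal hLδ
  have hTv := hbound hM' hvM hδ4 (r := s⁻¹) Set.subset_union_right
  have hTu := hbound hM huM hδ3 (r := s) Set.subset_union_left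
  -- Since `s⁻¹` need not lie in `S`, membership comes from the norm bound and not from
  -- admissibility.
  have hTv_mem : MemWeightedLp μ p ω (translate s⁻¹ (E.indicator v)) := by
    refine ⟨?_, hTv.trans_lt ENNReal.ofReal_lt_top⟩
    exact (hvE.comp_quasiMeasurePreserving
      (measurePreserving_mul_left μ s⁻¹⁻¹).quasiMeasurePreserving).mul
      (Complex.measurable_ofReal.comp_aemeasurable hω).aestronglyMeasurable
  have hvE' : MemWeightedLp μ p ω (E.indicator v) := by
    have := MemLp.indicator hE.measurableSet hv
    unfold MemWeightedLp
    convert this using 2 with t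
    by_cases ht : t ∈ E <;> simp [ht]
  obtain ⟨C, hC⟩ := hadm s hs
  have hTu_mem := (hC _ huE).1
  have hthree : ∀ {x y z : G → ℂ}, MemWeightedLp μ p ω x → MemWeightedLp μ p ω y →
      MemWeightedLp μ p ω z → weightedNorm μ p ω x ≤ ENNReal.ofReal (ε / 4) →
      weightedNorm μ p ω y ≤ ENNReal.ofReal (ε / 4) →
      weightedNorm μ p ω z ≤ ENNReal.ofReal (ε / 4) →
      weightedNorm μ p ω (x + (y + z)) < ENNReal.ofReal ε := by
    intro x y z hx hy hz hx' hy' hz'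
    calc weightedNorm μ p ω (x + (y + z))
        ≤ weightedNorm μ p ω x + (weightedNorm μ p ω y + weightedNorm μ p ω z) :=
          (weightedNorm_add_le hp hx (hy.add hz)).trans
            (add_le_add le_rfl (weightedNorm_add_le hp hy hz))
      _ ≤ ENNReal.ofReal (ε / 4) + (ENNReal.ofReal (ε / 4) + ENNReal.ofReal (ε / 4)) := by gcongr
      _ < ENNReal.ofReal ε := by
          rw [← ENNReal.ofReal_add hη.le hη.le, ← ENNReal.ofReal_add hη.le (by positivity),
            ENNReal.ofReal_lt_ofReal_iff hε]
          linarith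
  refine ⟨s, hs, E.indicator u + translate s⁻¹ (E.indicator v), huE.add hTv_mem, ?_, ?_⟩
  · have heq : E.indicator u + translate s⁻¹ (E.indicator v) - f
        = translate s⁻¹ (E.indicator v) + ((E.indicator u - u) + (u - f)) := by abel
    rw [heq]
    exact hthree hTv_mem (huE.sub hu) (hu.sub hf) hTv
      (weightedNorm_sub_indicator_le (F := K ∪ K') (fun t ht => huK t fun h => ht (Or.inl h))
        (hu' _ hdiff (hμ.le.trans (ENNReal.ofReal_le_ofReal hδ1)))) huf
  · have heq : translate s (E.indicator u + translate s⁻¹ (E.indicator v)) - g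
        = translate s (E.indicator u) + ((E.indicator v - v) + (v - g)) := by
      ext t
      simp [translate, add_sub_assoc]
    rw [heq]
    exact hthree hTu_mem (hvE'.sub hv) (hv.sub hg) hTu
      (weightedNorm_sub_indicator_le (F := K ∪ K') (fun t ht => hvK t fun h => ht (Or.inr h))
        (hv' _ hdiff (hμ.le.trans (ENNReal.ofReal_le_ofReal hδ2)))) hvg

end Sufficiency

/-- Birkhoff's transitivity criterion for a family of continuous self-maps of a complete separable
metric space. -/
theorem exists_dense_orbit_of_transitive {X ι : Type*} [PseudoEMetricSpace X] [BaireSpace X]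
    [SecondCountableTopology X] [Nonempty X] (T : ι → X → X) (hT : ∀ i, Continuous (T i))
    (h : ∀ x y : X, ∀ ε : ℝ≥0∞, 0 < ε → ∃ i, ∃ z, edist z x < ε ∧ edist (T i z) y < ε) :
    ∃ x, ∀ y : X, ∀ ε : ℝ≥0∞, 0 < ε → ∃ i, edist (T i x) y < ε := by
  let b := TopologicalSpace.countableBasis X
  have hb := TopologicalSpace.isBasis_countableBasis X
  have hbc : Countable b := TopologicalSpace.countable_countableBasis X
  have hopen : ∀ V : b, IsOpen (⋃ i, T i ⁻¹' V) := fun V =>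
    isOpen_iUnion fun i => (hb.isOpen V.2).preimage (hT i)
  have hdense : ∀ V : b, Dense (⋃ i, T i ⁻¹' (V : Set X)) := by
    intro V x
    rw [EMetric.mem_closure_iff]
    intro ε hε
    obtain ⟨y, hy⟩ := TopologicalSpace.nonempty_of_mem_countableBasis V.2
    obtain ⟨η, hη, hsub⟩ := EMetric.isOpen_iff.1 (hb.isOpen V.2) y hy
    obtain ⟨i, z, hz, hTz⟩ := h x y (min ε η) (lt_min hε hη)
    refine ⟨z, Set.mem_iUnion.2 ⟨i, hsub (hTz.trans_le (min_le_right _ _))⟩, ?_⟩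
    rw [edist_comm]
    exact hz.trans_le (min_le_left _ _)
  obtain ⟨x, hx⟩ := (dense_iInter_of_isOpen hopen hdense).nonempty
  refine ⟨x, fun y ε hε => ?_⟩
  obtain ⟨V, hV, hyV, hsub⟩ := hb.exists_subset_of_mem_open
    (Metric.mem_eball_self hε) Metric.isOpen_eball
  obtain ⟨i, hi⟩ := Set.mem_iUnion.1 (Set.mem_iInter.1 hx ⟨V, hV⟩)
  exact ⟨i, hsub hi⟩

/-! ### The weighted space as a copy of `L^p` -/

section WeightedLp

variable {G : Type*} [MeasurableSpace G] {μ : Measure G} {ω : G → ℝ} {p : ℝ≥0∞} {f g : G → ℂ}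

/-- The isometry `f ↦ f ω` of the weighted space into `L^p`. -/
noncomputable def MemWeightedLp.toLp (hf : MemWeightedLp μ p ω f) : Lp ℂ p μ :=
  MemLp.toLp (fun t => f t * (ω t : ℂ)) hf

theorem MemWeightedLp.coeFn_toLp (hf : MemWeightedLp μ p ω f) :
    hf.toLp =ᵐ[μ] fun t => f t * (ω t : ℂ) :=
  MemLp.coeFn_toLp hf

theorem MemWeightedLp.edist_toLp (hf : MemWeightedLp μ p ω f) (hg : MemWeightedLp μ p ω g) :
    edist hf.toLp hg.toLp = weightedNorm μ p ω (f - g) := by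
  refine (Lp.edist_toLp_toLp _ _ hf hg).trans ?_
  unfold weightedNorm
  congr 1
  ext t
  simp [sub_mul]

end WeightedLp

/-! ### Existence of dense vectors and the equivalence -/

section Main

variable {G : Type*} [Group G] [TopologicalSpace G] [MeasurableSpace G]
  [IsTopologicalGroup G] [BorelSpace G] [SecondCountableTopology G] [T2Space G]
  [LocallyCompactSpace G] {μ : Measure G} [μ.IsHaarMeasure] {ω : G → ℝ} {p : ℝ≥0∞} {S : Set G}

/-- Multiplication by `ω` identifies the weighted space with `Lp`, which is complete and separable,
so the translations become Lipschitz self-maps to which Birkhoff's criterion applies. -/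
theorem LpCondition.exists_isDenseVector (hp : 1 ≤ p) (hp_top : p ≠ ∞)
    (hω : AEMeasurable ω μ) (hpos : ∀ t, 0 < ω t) (hadm : IsAdmissible μ p ω S)
    (h : LpCondition μ p ω S) : ∃ f, IsDenseVector μ p ω S f := by
  have : Fact (1 ≤ p) := ⟨hp⟩
  have : Fact (p ≠ ∞) := ⟨hp_top⟩
  have hne : ∀ t, (ω t : ℂ) ≠ 0 := fun t => by exact_mod_cast (hpos t).ne'
  let φ : Lp ℂ p μ → G → ℂ := fun g t => g t * (ω t : ℂ)⁻¹
  have hφω : ∀ g : Lp ℂ p μ, (fun t => φ g t * (ω t : ℂ)) = g := fun g => by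
    ext t
    simp [φ, hne t]
  have hφ : ∀ g : Lp ℂ p μ, MemWeightedLp μ p ω (φ g) := fun g => by
    unfold MemWeightedLp
    rw [hφω]
    exact Lp.memLp g
  have hφ_toLp : ∀ {f : G → ℂ} (hf : MemWeightedLp μ p ω f),
      φ hf.toLp =ᵐ[μ] f := fun hf => by
    filter_upwards [hf.coeFn_toLp] with t ht
    simp [φ, ht, hne t]
  have htoLp_φ : ∀ g : Lp ℂ p μ, (hφ g).toLp = g := fun g => by
    refine Lp.ext ((hφ g).coeFn_toLp.trans ?_)
    rw [hφω]
  have hadm' : ∀ s : S, ∀ g : Lp ℂ p μ, MemWeightedLp μ p ω (translate (s : G) (φ g)) :=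
    fun s g => ((hadm s s.2).choose_spec _ (hφ g)).1
  let T : S → Lp ℂ p μ → Lp ℂ p μ := fun s g => (hadm' s g).toLp
  have hsub : ∀ (s : G) (f g : G → ℂ), translate s f - translate s g = translate s (f - g) :=
    fun _ _ _ => rfl
  have hT : ∀ s, Continuous (T s) := by
    intro s
    obtain ⟨C, hC⟩ := hadm s s.2
    refine LipschitzWith.continuous (K := C) fun g g' => ?_
    rw [MemWeightedLp.edist_toLp, hsub]
    conv_rhs => rw [← htoLp_φ g, ← htoLp_φ g', MemWeightedLp.edist_toLp]
    exact (hC _ ((hφ g).sub (hφ g'))).2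
  obtain ⟨x, hx⟩ := exists_dense_orbit_of_transitive T hT (by
    intro x y ε hε
    obtain ⟨η, hη, hηε⟩ := ENNReal.lt_iff_exists_nnreal_btwn.1 hε
    have hη' : ENNReal.ofReal η < ε := by rwa [ENNReal.ofReal_coe_nnreal]
    obtain ⟨s, hs, z, hz, hzx, hzy⟩ := h.exists_translate_approx hp hp_top hω hpos hadm (hφ x)
      (hφ y) (NNReal.coe_pos.2 (ENNReal.coe_pos.1 hη))
    refine ⟨⟨s, hs⟩, hz.toLp, ?_, ?_⟩
    · conv_lhs => rw [← htoLp_φ x, MemWeightedLp.edist_toLp]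
      exact hzx.trans hη'
    · conv_lhs => rw [← htoLp_φ y, MemWeightedLp.edist_toLp]
      refine lt_of_eq_of_lt (weightedNorm_congr_ae ?_) (hzy.trans hη')
      -- `φ hz.toLp` agrees with `z` only almost everywhere; translation preserves null sets, so
      -- this survives applying `T_s`.
      have hae := (measurePreserving_mul_left μ s⁻¹).quasiMeasurePreserving.ae_eq_comp (hφ_toLp hz)
      exact hae.sub (Filter.EventuallyEq.refl _ _))
  refine ⟨φ x, hφ x, fun s hs => hadm' ⟨s, hs⟩ x, fun g hg ε hε => ?_⟩
  obtain ⟨s, hs⟩ := hx (hg.toLp) (ENNReal.ofReal ε) (ENNReal.ofReal_pos.2 hε)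
  rw [MemWeightedLp.edist_toLp] at hs
  exact ⟨s, s.2, hs⟩

end Main

end WeightedTranslates

theorem mainTheorem3 {G : Type*} [Group G] [TopologicalSpace G] [IsTopologicalGroup G]
    [T2Space G] [LocallyCompactSpace G] [SecondCountableTopology G] [NoncompactSpace G]
    [MeasurableSpace G] [BorelSpace G] (μ : Measure G) [μ.IsHaarMeasure]
    (S : Set G) (hS : IsMulCommutative (Subgroup.closure S))
    (p₀ : ℝ≥0∞) (hp₀ : 1 ≤ p₀) (hp₀_top : p₀ ≠ ∞) (ω : G → ℝ)
    (hω : WeightedTranslates.IsWeight μ p₀ ω)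
    (hadm : WeightedTranslates.IsAdmissible μ p₀ ω S) :
    List.TFAE [
      ∀ p : ℝ≥0∞, 1 ≤ p → p ≠ ∞ → ∃ f : G → ℂ, WeightedTranslates.IsDenseVector μ p ω S f,
      ∃ p : ℝ≥0∞, 1 ≤ p ∧ p ≠ ∞ ∧ ∃ f : G → ℂ, WeightedTranslates.IsDenseVector μ p ω S f,
      WeightedTranslates.EssSupCondition μ ω S,
      ∃ p : ℝ≥0∞, 1 ≤ p ∧ p ≠ ∞ ∧ WeightedTranslates.LpCondition μ p ω S,
      ∀ p : ℝ≥0∞, 1 ≤ p → p ≠ ∞ → WeightedTranslates.LpCondition μ p ω S] := by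
  have hne : ∀ {p : ℝ≥0∞}, 1 ≤ p → p ≠ 0 := fun hp => (zero_lt_one.trans_le hp).ne'
  have hadm' := hadm.exponent (hne hp₀) hp₀_top hω.aemeasurable hω.pos
  have hcomm : ∀ s ∈ S, ∀ t ∈ S, s * t = t * s := fun s hs t ht =>
    congrArg Subtype.val (hS.is_comm.comm ⟨s, Subgroup.subset_closure hs⟩
      ⟨t, Subgroup.subset_closure ht⟩)
  tfae_have 1 → 2 := fun h => ⟨1, le_rfl, ENNReal.one_ne_top, h 1 le_rfl ENNReal.one_ne_top⟩
  tfae_have 2 → 4 := fun ⟨p, hp, hp_top, _, hf⟩ =>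
    ⟨p, hp, hp_top, hf.lpCondition hcomm hp hp_top hω.aemeasurable hω.pos (hadm' p)⟩
  tfae_have 4 → 3 := fun ⟨_, hp, hp_top, h⟩ =>
    h.essSupCondition hω.aemeasurable hω.pos (hne hp) hp_top
  tfae_have 3 → 5 := fun h _ hp hp_top => h.lpCondition hω.pos (hne hp) hp_top
  tfae_have 5 → 1 := fun h p hp hp_top =>
    (h p hp hp_top).exists_isDenseVector hp hp_top hω.aemeasurable hω.pos (hadm' p)
  tfae_finish
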